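/- Let $\mathcal H$ be a real separable Hilbert space. Write $\mathrm L(\mathcal H)$ for the bounded operators on $\mathcal H$ with the operator norm, $\mathrm{GL}(\mathcal H)$ for the invertible and $\mathrm O(\mathcal H)$ for the orthogonal ones. A symmetry of $\mathcal H$ is a bounded self-adjoint operator $\mathfrak I$ with $\mathfrak I^2=I$. A family $\{\mathcal V_t\}_{t\in[a,b]}$ of closed subspaces of $\mathcal H$ is continuous if for every $t_0\in[a,b]$ there are $\varepsilon>0$, a closed subspace $\mathcal V_\star\subseteq\mathcal H$ and a norm-continuous map $t\mapsto\Psi_t\in\mathrm{GL}(\mathcal H)$ on $[a,b]\cap{]t_0-\varepsilon,t_0+\varepsilon[}$ with $\Psi_t(\mathcal V_t)=\mathcal V_\star$ for all $t$ in that set. An orthogonal trivialization of the family is a pair $(\mathcal V_\star,\Psi)$ consisting of a closed subspace $\mathcal V_\star\subseteq\mathcal H$ and a norm-continuous map $\Psi:[a,b]\to\mathrm O(\mathcal H)$ with $\Psi_t(\mathcal V_t)=\mathcal V_\star$ for all $t\in[a,b]$. **Proposition.** Let $a\le b$ and let $T$ be a norm-continuous path, defined on $[a,b]$, of bounded self-adjoint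 Fredholm operators on $\mathcal H$, of the form $T_t=\mathfrak I+K_t$, where $\mathfrak I$ is a fixed symmetry of $\mathcal H$ and each $K_t$ is a self-adjoint compact operator on $\mathcal H$. Let $\mathcal D=\{\mathcal V_t\}_{t\in[a,b]}$ be a continuous family of closed subspaces of $\mathcal H$, each of finite codimension. Then there exist an orthogonal trivialization $(\mathcal V_\star,\Psi)$ of $\mathcal D$, with $\mathcal V_\star$ of finite codimension, and a symmetry $\widetilde{\mathfrak J}$ of $\mathcal H$ such that $\Psi_tT_t\Psi_t^*-\widetilde{\mathfrak J}$ is compact for all $t\in[a,b]$. -/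

import Mathlib

open Set

/-- A symmetry of a real Hilbert space: a bounded self-adjoint operator whose square is the
identity. -/
def IsSymmetry {H : Type*} [NormedAddCommGroup H] [InnerProductSpace ℝ H] [CompleteSpace H]
    (J : H →L[ℝ] H) : Prop :=
  IsSelfAdjoint J ∧ J ∘L J = ContinuousLinearMap.id ℝ H

/-- The pair `(Vstar, Ψ)` trivializes the family `V` over the set `I` of parameters: `Vstar` is a
closed subspace, `Ψ` is a norm-continuous map on `I` with values in the automorphisms
of `H`, and `Ψ t` carries `V t` onto `Vstar` for all `t ∈ I`. (Values of `Ψ` and `V` outside `I`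
are irrelevant.) -/
structure IsTrivialization {H : Type*} [NormedAddCommGroup H] [InnerProductSpace ℝ H]
    (V : ℝ → Submodule ℝ H) (I : Set ℝ) (Vstar : Submodule ℝ H) (Ψ : ℝ → H ≃L[ℝ] H) : Prop where
  isClosed : IsClosed (Vstar : Set H)
  continuousOn : ContinuousOn (fun t => (Ψ t : H →L[ℝ] H)) I
  map_eq : ∀ t ∈ I, (V t).map ((Ψ t : H →L[ℝ] H) : H →ₗ[ℝ] H) = Vstar

/-- A continuous (that is, `C⁰`) family of closed subspaces over `I`: near each parameter in `I`
there is a local trivialization. -/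
def IsContinuousFamily {H : Type*} [NormedAddCommGroup H] [InnerProductSpace ℝ H]
    (V : ℝ → Submodule ℝ H) (I : Set ℝ) : Prop :=
  (∀ t ∈ I, IsClosed (V t : Set H)) ∧
  ∀ t₀ ∈ I, ∃ ε > 0, ∃ (Vstar : Submodule ℝ H) (Ψ : ℝ → H ≃L[ℝ] H),
    IsTrivialization V (I ∩ Ioo (t₀ - ε) (t₀ + ε)) Vstar Ψ

/-- An orthogonal trivialization over `I`: a trivialization over all of `I` by elements of the
orthogonal group `O(H)` (the unitary group of the bounded operators on the real space `H`). -/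
def IsOrthogonalTrivialization {H : Type*} [NormedAddCommGroup H] [InnerProductSpace ℝ H]
    [CompleteSpace H] (V : ℝ → Submodule ℝ H) (I : Set ℝ) (Vstar : Submodule ℝ H)
    (Ψ : ℝ → H ≃L[ℝ] H) : Prop :=
  IsTrivialization V I Vstar Ψ ∧ ∀ t ∈ I, (Ψ t : H →L[ℝ] H) ∈ unitary (H →L[ℝ] H)

/-!
The orthogonal operators of the form `1 + compact` form a group `orthogonalCompactGroup H`.
Conjugating by such an operator `U` changes any bounded operator only by a compact one, because
`U J U* - J = (U - 1) J U* + J (U* - 1)`. Hence it suffices to trivialize the family of subspaces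
by a continuous path in this group: the symmetry `J` itself then serves for all parameters.

Locally, a trivialization `Ψ` with model `Vstar` identifies the orthogonal complement of `V t` with
the image under `(Ψ t)*` of the fixed finite-dimensional space `Vstarᗮ`. Such an image is moved to
a fixed subspace one generator at a time (`exists_straightening`): when the first generators
already span a fixed space `W`, the component of the next one orthogonal to `W` is carried to a
fixed line by a Householder reflection, which fixes `W` pointwise and depends continuously on the
parameter near the given point. Taking orthogonal complements gives local trivializations by
elements of the group (`CompactlyTrivial.exists_local`).

Two trivializations over adjacent intervals are joined by multiplying the second one by a constant
group element which makes them agree at the common endpoint (`CompactlyTrivial.glue`), and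
compactness of `[a, b]` finishes the construction.
-/

open Topology

/-! ### Orthogonal operators that are compact perturbations of the identity -/

section Group

variable {H : Type*} [NormedAddCommGroup H] [InnerProductSpace ℝ H] [CompleteSpace H]

variable (H) in
/-- The group of orthogonal operators `U` on `H` such that `U - 1` is compact, as a subgroup of the
orthogonal group with its norm topology. -/
def orthogonalCompactGroup : Subgroup (unitary (H →L[ℝ] H)) where
  carrier := {U | IsCompactOperator ⇑((U : H →L[ℝ] H) - 1)}
  one_mem' := by
    have h : ((1 : unitary (H →L[ℝ] H)) : H →L[ℝ] H) - 1 = 0 := by simp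
    simp only [Set.mem_ofPred_eq, h]
    exact isCompactOperator_zero
  mul_mem' {U U'} hU hU' := by
    have h : ((U * U' : unitary (H →L[ℝ] H)) : H →L[ℝ] H) - 1
        = ((U : H →L[ℝ] H) - 1) ∘L (U' : H →L[ℝ] H) + ((U' : H →L[ℝ] H) - 1) := by
      ext x; simp
    simp only [Set.mem_ofPred_eq, h]
    exact (IsCompactOperator.comp_clm hU _).add hU'
  inv_mem' {U} hU := by
    have h : ((U⁻¹ : unitary (H →L[ℝ] H)) : H →L[ℝ] H) - 1
        = -(((U⁻¹ : unitary (H →L[ℝ] H)) : H →L[ℝ] H) ∘L ((U : H →L[ℝ] H) - 1)) := by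
      have h1 : ((U⁻¹ : unitary (H →L[ℝ] H)) : H →L[ℝ] H) * (U : H →L[ℝ] H) = 1 := by
        exact congrArg Subtype.val (inv_mul_cancel U)
      change _ = -(((U⁻¹ : unitary (H →L[ℝ] H)) : H →L[ℝ] H) * ((U : H →L[ℝ] H) - 1))
      rw [mul_sub, h1, mul_one, neg_sub]
    simp only [Set.mem_ofPred_eq, h]
    exact (IsCompactOperator.clm_comp hU ((U⁻¹ : unitary (H →L[ℝ] H)) : H →L[ℝ] H)).neg

namespace orthogonalCompactGroup

/-- The isometric equivalence of `H` given by an element of the group. -/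
noncomputable def equiv (U : orthogonalCompactGroup H) : H ≃ₗᵢ[ℝ] H :=
  Unitary.linearIsometryEquiv U.1

theorem coe_equiv (U : orthogonalCompactGroup H) :
    ((equiv U).toContinuousLinearEquiv : H →L[ℝ] H) = U.1.1 := rfl

theorem map_equiv_mul (U U' : orthogonalCompactGroup H) (M : Submodule ℝ H) :
    M.map (equiv (U * U')).toLinearEquiv.toLinearMap
      = (M.map (equiv U').toLinearEquiv.toLinearMap).map (equiv U).toLinearEquiv.toLinearMap := by
  rw [← Submodule.map_comp]; rfl

theorem map_equiv_inv_map (U : orthogonalCompactGroup H) (M : Submodule ℝ H) :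
    (M.map (equiv U).toLinearEquiv.toLinearMap).map (equiv U⁻¹).toLinearEquiv.toLinearMap = M := by
  rw [← map_equiv_mul, inv_mul_cancel]
  exact Submodule.map_id M

theorem continuousOn_apply {X : Type*} [TopologicalSpace X] {S : Set X}
    {U : X → orthogonalCompactGroup H} (hU : ContinuousOn U S) {v : X → H}
    (hv : ContinuousOn v S) : ContinuousOn (fun x => equiv (U x) (v x)) S :=
  ((continuous_subtype_val.comp continuous_subtype_val).comp_continuousOn hU).clm_apply hv

/-- Conjugating a bounded operator by an element of the group changes it by a compact operator. -/
theorem isCompactOperator_conj_sub (U : orthogonalCompactGroup H) (J : H →L[ℝ] H) :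
    IsCompactOperator (U.1.1 ∘L J ∘L ContinuousLinearMap.adjoint U.1.1 - J) := by
  have h : U.1.1 ∘L J ∘L ContinuousLinearMap.adjoint U.1.1 - J
      = (U.1.1 - 1) ∘L (J ∘L ContinuousLinearMap.adjoint U.1.1)
        + J ∘L ((U⁻¹).1.1 - 1) := by
    ext x
    have : (((U⁻¹ : orthogonalCompactGroup H) : unitary (H →L[ℝ] H)) : H →L[ℝ] H)
        = ContinuousLinearMap.adjoint U.1.1 := rfl
    rw [this]
    simp
  rw [h]
  exact (IsCompactOperator.comp_clm U.2 _).add (IsCompactOperator.clm_comp (U⁻¹).2 _)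

end orthogonalCompactGroup

/-! ### Householder reflections -/

omit [CompleteSpace H] in
theorem coe_reflection_orthogonal_singleton (w : H) :
    ((Submodule.reflection (ℝ ∙ w)ᗮ : H ≃ₗᵢ[ℝ] H) : H →L[ℝ] H)
      = 1 - (2 / ‖w‖ ^ 2) • InnerProductSpace.rankOne ℝ w w := by
  ext x
  have h := Submodule.reflection_singleton_apply (𝕜 := ℝ) w x
  have h' := Submodule.reflection_orthogonal_apply (K := ℝ ∙ w) x
  rw [h] at h'
  refine h'.trans ?_
  simp only [RCLike.ofReal_real_eq_id, id_eq, neg_sub, sub_apply,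
    one_apply_eq_self, smul_apply, InnerProductSpace.rankOne_apply, smul_smul,
    two_smul, ← add_smul]
  congr 2
  ring

/-- The reflection in the hyperplane orthogonal to `w`; it is the identity if `w = 0`. -/
noncomputable def householder (w : H) : orthogonalCompactGroup H :=
  ⟨Unitary.linearIsometryEquiv.symm (Submodule.reflection (ℝ ∙ w)ᗮ), by
    change IsCompactOperator
      ⇑(((Submodule.reflection (ℝ ∙ w)ᗮ : H ≃ₗᵢ[ℝ] H) : H →L[ℝ] H) - 1)
    rw [coe_reflection_orthogonal_singleton, sub_sub_cancel_left]
    refine IsCompactOperator.neg (IsCompactOperator.smul ?_ _)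
    rw [InnerProductSpace.rankOne_def']
    have h : IsCompactOperator ⇑(ContinuousLinearMap.toSpanSingleton ℝ w) :=
      isCompactOperator_of_locallyCompactSpace_rng _
    exact h.comp_clm (innerSL ℝ w)⟩

theorem equiv_householder (w : H) :
    orthogonalCompactGroup.equiv (householder w) = Submodule.reflection (ℝ ∙ w)ᗮ :=
  Unitary.linearIsometryEquiv.apply_symm_apply _

theorem continuousOn_householder : ContinuousOn (householder (H := H)) {0}ᶜ := by
  refine (IsInducing.subtypeVal.comp IsInducing.subtypeVal).continuousOn_iff.2 ?_
  change ContinuousOn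
    (fun w : H => ((Submodule.reflection (ℝ ∙ w)ᗮ : H ≃ₗᵢ[ℝ] H) : H →L[ℝ] H)) {0}ᶜ
  simp only [coe_reflection_orthogonal_singleton]
  have hr : Continuous fun w : H => InnerProductSpace.rankOne ℝ w w := by
    simp only [InnerProductSpace.rankOne_def]
    exact ((ContinuousLinearMap.smulRightL ℝ H H).continuous₂).comp
      ((innerSL ℝ (E := H)).continuous.prodMk continuous_id)
  have hc : ContinuousOn (fun w : H => 2 / ‖w‖ ^ 2) {0}ᶜ :=
    continuousOn_const.div (by fun_prop) fun w hw => by simpa using hw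
  exact continuousOn_const.sub (hc.smul hr.continuousOn)

/-- A subspace orthogonal to the direction of reflection is preserved. -/
theorem map_householder_of_mem_orthogonal {W : Submodule ℝ H} {w : H} (hw : w ∈ Wᗮ) :
    W.map (orthogonalCompactGroup.equiv (householder w)).toLinearEquiv.toLinearMap = W := by
  have h : ∀ y ∈ W, orthogonalCompactGroup.equiv (householder w) y = y := fun y hy => by
    rw [equiv_householder]
    refine Submodule.reflection_mem_subspace_eq_self ?_
    rw [Submodule.mem_orthogonal_singleton_iff_inner_right]
    exact Submodule.inner_left_of_mem_orthogonal hy hw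
  ext y
  constructor
  · rintro ⟨z, hz, rfl⟩
    exact (h z hz).symm ▸ hz
  · exact fun hy => ⟨y, hy, h y hy⟩

/-- The vector `‖g‖ • e + ‖e‖ • g` is the difference of `‖e‖ • g` and `-(‖g‖ • e)`, which have the
same norm, so the corresponding reflection exchanges the two. -/
theorem map_householder_span_singleton {e g : H} (he : e ≠ 0) (hg : g ≠ 0) :
    (ℝ ∙ g).map (orthogonalCompactGroup.equiv
      (householder (‖g‖ • e + ‖e‖ • g))).toLinearEquiv.toLinearMap = ℝ ∙ e := by
  have he' : ‖e‖ ≠ 0 := norm_ne_zero_iff.2 he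
  have hg' : ‖g‖ ≠ 0 := norm_ne_zero_iff.2 hg
  have hw : ‖g‖ • e + ‖e‖ • g = ‖e‖ • g - (-‖g‖) • e := by
    rw [neg_smul, sub_neg_eq_add, add_comm]
  rw [← Submodule.span_singleton_smul_eq (IsUnit.mk0 _ he') g,
    ← Submodule.span_singleton_smul_eq (IsUnit.mk0 _ (neg_ne_zero.2 hg')) e,
    Submodule.map_span, Set.image_singleton, hw]
  congr 2
  exact Submodule.reflection_sub (by simp [norm_smul, mul_comm])

end Group

/-! ### Straightening a continuous family of finite-dimensional subspaces -/

section Straightening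

variable {H : Type*} [NormedAddCommGroup H] [InnerProductSpace ℝ H] [CompleteSpace H]

open orthogonalCompactGroup

/-- Near any parameter, the images of a fixed finitely generated subspace under a norm-continuous
family of injective operators are carried onto a fixed subspace by a continuous family in
`orthogonalCompactGroup H`. -/
theorem exists_straightening {X : Type*} [TopologicalSpace X] {S : Set X} {x₀ : X} (hx₀ : x₀ ∈ S)
    {A : X → H →L[ℝ] H} (hA : ContinuousOn A S) (hinj : ∀ x ∈ S, Function.Injective (A x))
    (s : Finset H) :
    ∃ O : Set X, IsOpen O ∧ x₀ ∈ O ∧ ∃ U : X → orthogonalCompactGroup H, ContinuousOn U (S ∩ O) ∧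
      ∃ W : Submodule ℝ H, FiniteDimensional ℝ W ∧ ∀ x ∈ S ∩ O,
        ((Submodule.span ℝ (s : Set H)).map (A x).toLinearMap).map
          (equiv (U x)).toLinearEquiv.toLinearMap = W := by
  classical
  induction s using Finset.induction_on with
  | empty =>
    exact ⟨univ, isOpen_univ, mem_univ _, fun _ => 1, continuousOn_const, ⊥, inferInstance,
      fun x _ => by simp⟩
  | insert v s _ ih =>
    obtain ⟨O, hO, hxO, U, hU, W, hW, hUW⟩ := ih
    by_cases hv : v ∈ Submodule.span ℝ (s : Set H)
    · refine ⟨O, hO, hxO, U, hU, W, hW, fun x hx => ?_⟩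
      rw [Finset.coe_insert, Submodule.span_insert_eq_span hv]
      exact hUW x hx
    set g : X → H := fun x => Wᗮ.starProjection (equiv (U x) (A x v)) with hgdef
    have hgc : ContinuousOn g (S ∩ O) :=
      Wᗮ.starProjection.continuous.comp_continuousOn
        (continuousOn_apply hU ((hA.mono inter_subset_left).clm_apply continuousOn_const))
    have hgW : ∀ x, g x ∈ Wᗮ := fun x => Submodule.starProjection_apply_mem _ _
    have hsub : ∀ x, equiv (U x) (A x v) - g x ∈ W := fun x => by
      have h := Submodule.starProjection_orthogonal_val (K := W) (equiv (U x) (A x v))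
      rw [hgdef]
      simp only [h, sub_sub_cancel]
      exact Submodule.starProjection_apply_mem _ _
    have hg0 : ∀ x ∈ S ∩ O, g x ≠ 0 := fun x hx h0 => by
      have h1 := hsub x
      rw [h0, sub_zero, ← hUW x hx] at h1
      obtain ⟨_, ⟨u, hu, rfl⟩, h2⟩ := h1
      exact hv (hinj x hx.1 ((equiv (U x)).injective h2) ▸ hu)
    set e := g x₀
    have he : e ≠ 0 := hg0 x₀ ⟨hx₀, hxO⟩
    have heW : e ∈ Wᗮ := hgW x₀
    set w : X → H := fun x => ‖g x‖ • e + ‖e‖ • g x with hwdef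
    have hwc : ContinuousOn w (S ∩ O) :=
      (hgc.norm.smul continuousOn_const).add (hgc.const_smul _)
    have hw0 : w x₀ ≠ 0 := by
      change ‖e‖ • e + ‖e‖ • e ≠ 0
      rw [← two_smul ℝ]
      exact smul_ne_zero two_ne_zero (smul_ne_zero (norm_ne_zero_iff.2 he) he)
    obtain ⟨O', hO', hxO', hsubO⟩ := mem_nhdsWithin.1
      ((hwc x₀ ⟨hx₀, hxO⟩).eventually_ne hw0)
    refine ⟨O ∩ O', hO.inter hO', ⟨hxO, hxO'⟩, fun x => householder (w x) * U x, ?_, W ⊔ ℝ ∙ e,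
      inferInstance, fun x hx => ?_⟩
    · have hm : S ∩ (O ∩ O') ⊆ S ∩ O := fun x hx => ⟨hx.1, hx.2.1⟩
      exact (continuousOn_householder.comp (hwc.mono hm)
        fun x hx => hsubO ⟨hx.2.2, hx.1, hx.2.1⟩).mul (hU.mono hm)
    · have hxO : x ∈ S ∩ O := ⟨hx.1, hx.2.1⟩
      have hwW : w x ∈ Wᗮ := Wᗮ.add_mem (Wᗮ.smul_mem _ heW) (Wᗮ.smul_mem _ (hgW x))
      -- modulo `W`, the next generator may be replaced by its component orthogonal to `W`
      have key : (ℝ ∙ equiv (U x) (A x v)) ⊔ W = (ℝ ∙ g x) ⊔ W := by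
        apply le_antisymm
        · refine sup_le ((Submodule.span_singleton_le_iff_mem _ _).2 ?_) le_sup_right
          exact Submodule.mem_sup.2
            ⟨g x, Submodule.mem_span_singleton_self _, _, hsub x, add_sub_cancel _ _⟩
        · refine sup_le ((Submodule.span_singleton_le_iff_mem _ _).2 ?_) le_sup_right
          exact Submodule.mem_sup.2 ⟨_, Submodule.mem_span_singleton_self _, _,
            W.neg_mem (hsub x), by abel⟩
      have hsv : ((ℝ ∙ v).map (A x).toLinearMap).map (equiv (U x)).toLinearEquiv.toLinearMap
          = ℝ ∙ equiv (U x) (A x v) := by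
        rw [Submodule.map_span, Submodule.map_span, Set.image_singleton, Set.image_singleton]
        rfl
      rw [map_equiv_mul, Finset.coe_insert, Submodule.span_insert, Submodule.map_sup, Submodule.map_sup,
        hUW x hxO, hsv, key, Submodule.map_sup, map_householder_of_mem_orthogonal hwW,
        map_householder_span_singleton he (hg0 x hxO), sup_comm]

end Straightening

/-! ### Trivializations in the group -/

section Trivialization

variable {H : Type*} [NormedAddCommGroup H] [InnerProductSpace ℝ H] [CompleteSpace H]

open orthogonalCompactGroup

/-- The family `V` is carried onto a fixed subspace, over the parameter set `S`, by a continuous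
map into `orthogonalCompactGroup H`. -/
def CompactlyTrivial (V : ℝ → Submodule ℝ H) (S : Set ℝ) : Prop :=
  ∃ (W : Submodule ℝ H) (U : ℝ → orthogonalCompactGroup H), ContinuousOn U S ∧
    ∀ t ∈ S, (V t).map (equiv (U t)).toLinearEquiv.toLinearMap = W

theorem CompactlyTrivial.mono {V : ℝ → Submodule ℝ H} {S S' : Set ℝ} (h : CompactlyTrivial V S)
    (hS : S' ⊆ S) : CompactlyTrivial V S' := by
  obtain ⟨W, U, hU, hW⟩ := h
  exact ⟨W, U, hU.mono hS, fun t ht => hW t (hS ht)⟩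

theorem CompactlyTrivial.glue {V : ℝ → Submodule ℝ H} {a c d : ℝ} (hac : a ≤ c) (hcd : c ≤ d)
    (h₁ : CompactlyTrivial V (Icc a c)) (h₂ : CompactlyTrivial V (Icc c d)) :
    CompactlyTrivial V (Icc a d) := by
  obtain ⟨W₁, U₁, hU₁, hW₁⟩ := h₁
  obtain ⟨W₂, U₂, hU₂, hW₂⟩ := h₂
  let U : ℝ → orthogonalCompactGroup H :=
    fun t => if t ≤ c then U₁ t else U₁ c * (U₂ c)⁻¹ * U₂ t
  have e₁ : ∀ t ∈ Icc a c, U t = U₁ t := fun t ht => if_pos ht.2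
  have e₂ : ∀ t ∈ Icc c d, U t = U₁ c * (U₂ c)⁻¹ * U₂ t := fun t ht => by
    rcases ht.1.eq_or_lt with rfl | h
    · rw [inv_mul_cancel_right]; exact if_pos le_rfl
    · exact if_neg h.not_ge
  refine ⟨W₁, U, ?_, fun t ht => ?_⟩
  · rw [← Icc_union_Icc_eq_Icc hac hcd]
    exact (hU₁.congr e₁).union_of_isClosed ((continuousOn_const.mul hU₂).congr e₂)
      isClosed_Icc isClosed_Icc
  · rcases le_total t c with h | h
    · rw [e₁ t ⟨ht.1, h⟩]
      exact hW₁ t ⟨ht.1, h⟩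
    · rw [e₂ t ⟨h, ht.2⟩, map_equiv_mul, map_equiv_mul, hW₂ t ⟨h, ht.2⟩, ← hW₂ c ⟨le_rfl, hcd⟩, map_equiv_inv_map]
      exact hW₁ c ⟨hac, le_rfl⟩

/-- A closed subspace is the orthogonal complement of the image, under the adjoint of an
automorphism, of the orthogonal complement of its own image. -/
theorem orthogonal_map_adjoint {V W : Submodule ℝ H} (hW : IsClosed (W : Set H)) (Ψ : H ≃L[ℝ] H)
    (h : V.map ((Ψ : H →L[ℝ] H) : H →ₗ[ℝ] H) = W) :
    (Wᗮ.map (ContinuousLinearMap.adjoint (Ψ : H →L[ℝ] H)).toLinearMap)ᗮ = V := by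
  have hWW : Wᗮᗮ = W := by
    rw [Submodule.orthogonal_orthogonal_eq_closure, hW.submodule_topologicalClosure_eq]
  ext x
  have hx : x ∈ V ↔ Ψ x ∈ Wᗮᗮ := by
    rw [hWW, ← h]
    constructor
    · exact fun hx => ⟨x, hx, rfl⟩
    · rintro ⟨y, hy, hyx⟩
      exact Ψ.injective hyx ▸ hy
  rw [hx, Submodule.mem_orthogonal, Submodule.mem_orthogonal]
  constructor
  · intro hy u hu
    have := hy _ ⟨u, hu, rfl⟩
    simpa [ContinuousLinearMap.adjoint_inner_left] using this
  · rintro hy _ ⟨u, hu, rfl⟩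
    simpa [ContinuousLinearMap.adjoint_inner_left] using hy u hu

omit [CompleteSpace H] in
theorem finiteDimensional_quotient_map {V W : Submodule ℝ H} (e : H ≃ₗ[ℝ] H)
    (h : V.map e.toLinearMap = W) [FiniteDimensional ℝ (H ⧸ V)] : FiniteDimensional ℝ (H ⧸ W) :=
  (Submodule.Quotient.equiv V W e h).finiteDimensional

omit [CompleteSpace H] in
theorem finiteDimensional_orthogonal {W : Submodule ℝ H} [FiniteDimensional ℝ (H ⧸ W)] :
    FiniteDimensional ℝ Wᗮ := by
  refine FiniteDimensional.of_injective (W.mkQ ∘ₗ Wᗮ.subtype) ?_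
  rw [← LinearMap.ker_eq_bot, LinearMap.ker_comp, Submodule.ker_mkQ]
  exact Submodule.disjoint_iff_comap_eq_bot.1 W.orthogonal_disjoint.symm

theorem CompactlyTrivial.exists_local {V : ℝ → Submodule ℝ H} {I : Set ℝ}
    (hV : IsContinuousFamily V I) (hVcodim : ∀ t ∈ I, FiniteDimensional ℝ (H ⧸ V t))
    {t₀ : ℝ} (ht₀ : t₀ ∈ I) :
    ∃ O : Set ℝ, IsOpen O ∧ t₀ ∈ O ∧ CompactlyTrivial V (I ∩ O) := by
  obtain ⟨ε, hε, Vs, Ψ, hΨ⟩ := hV.2 t₀ ht₀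
  have hmem : t₀ ∈ I ∩ Ioo (t₀ - ε) (t₀ + ε) := ⟨ht₀, by linarith, by linarith⟩
  have : FiniteDimensional ℝ (H ⧸ V t₀) := hVcodim t₀ ht₀
  have : FiniteDimensional ℝ (H ⧸ Vs) :=
    finiteDimensional_quotient_map (Ψ t₀).toLinearEquiv (hΨ.map_eq t₀ hmem)
  have hfd : FiniteDimensional ℝ Vsᗮ := finiteDimensional_orthogonal
  obtain ⟨s, hs⟩ := (Submodule.fg_iff_finiteDimensional Vsᗮ).2 hfd
  have hinj : ∀ t, Function.Injective (ContinuousLinearMap.adjoint (Ψ t : H →L[ℝ] H)) := by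
    intro t
    refine (injective_iff_map_eq_zero _).2 fun x hx => ?_
    obtain ⟨y, rfl⟩ := (Ψ t).surjective x
    have h := ContinuousLinearMap.adjoint_inner_left (Ψ t : H →L[ℝ] H) y (Ψ t y)
    rw [hx, inner_zero_left] at h
    exact inner_self_eq_zero.1 h.symm
  obtain ⟨O, hO, hxO, U, hU, W, -, hUW⟩ := exists_straightening hmem
    ((ContinuousLinearMap.adjoint (𝕜 := ℝ) (E := H) (F := H)).continuous.comp_continuousOn
      hΨ.continuousOn) (fun t _ => hinj t) s
  refine ⟨Ioo (t₀ - ε) (t₀ + ε) ∩ O, isOpen_Ioo.inter hO, ⟨hmem.2, hxO⟩, Wᗮ, U, ?_, fun t ht => ?_⟩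
  · rwa [← inter_assoc]
  · rw [← inter_assoc] at ht
    rw [← hUW t ht, ← Submodule.map_orthogonal_equiv, hs]
    congr 1
    exact (orthogonal_map_adjoint hΨ.isClosed (Ψ t) (hΨ.map_eq t ht.1)).symm

theorem IsContinuousFamily.compactlyTrivial {V : ℝ → Submodule ℝ H} {a b : ℝ} (hab : a ≤ b)
    (hV : IsContinuousFamily V (Icc a b))
    (hVcodim : ∀ t ∈ Icc a b, FiniteDimensional ℝ (H ⧸ V t)) :
    CompactlyTrivial V (Icc a b) := by
  choose O hO hmem hOV using fun t : Icc a b => CompactlyTrivial.exists_local hV hVcodim t.2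
  obtain ⟨t, ht0, hmono, ⟨m, hm⟩, hcov⟩ := exists_monotone_Icc_subset_open_cover_Icc hab
    (c := fun i : Icc a b => Subtype.val ⁻¹' O i)
    (fun i => (hO i).preimage continuous_subtype_val) (fun i _ => mem_iUnion.2 ⟨i, hmem i⟩)
  have step : ∀ n, CompactlyTrivial V (Icc a (t n)) := by
    intro n
    induction n with
    | zero =>
      refine ⟨(V a).map (equiv 1).toLinearEquiv.toLinearMap, fun _ => 1, continuousOn_const,
        fun s hs => ?_⟩
      rw [ht0, Icc_self] at hs
      rw [hs]
    | succ n ih =>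
      refine ih.glue (t n).2.1 (hmono n.le_succ) ?_
      obtain ⟨i, hi⟩ := hcov n
      refine (hOV i).mono fun s hs => ?_
      have hs' : s ∈ Icc a b := ⟨(t n).2.1.trans hs.1, hs.2.trans (t (n + 1)).2.2⟩
      exact ⟨hs', @hi ⟨s, hs'⟩ ⟨hs.1, hs.2⟩⟩
  exact hm m le_rfl ▸ step m

end Trivialization

open orthogonalCompactGroup in
theorem proposition4p14 {H : Type*} [NormedAddCommGroup H] [InnerProductSpace ℝ H]
    [CompleteSpace H] [TopologicalSpace.SeparableSpace H]
    (a b : ℝ) (hab : a ≤ b)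
    (T K : ℝ → H →L[ℝ] H) (J : H →L[ℝ] H)
    (hTcont : ContinuousOn T (Set.Icc a b))
    (hTfred : ∀ t ∈ Set.Icc a b, (T t).IsFredholm ∧ IsSelfAdjoint (T t))
    (hJ : IsSymmetry J)
    (hK : ∀ t ∈ Set.Icc a b, IsSelfAdjoint (K t) ∧ IsCompactOperator (K t))
    (hT : ∀ t ∈ Set.Icc a b, T t = J + K t)
    (V : ℝ → Submodule ℝ H)
    (hV : IsContinuousFamily V (Set.Icc a b))
    (hVcodim : ∀ t ∈ Set.Icc a b, FiniteDimensional ℝ (H ⧸ V t)) :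
    ∃ (Vstar : Submodule ℝ H) (Ψ : ℝ → H ≃L[ℝ] H) (Jtilde : H →L[ℝ] H),
      IsOrthogonalTrivialization V (Set.Icc a b) Vstar Ψ ∧
      FiniteDimensional ℝ (H ⧸ Vstar) ∧
      IsSymmetry Jtilde ∧
      ∀ t ∈ Set.Icc a b,
        IsCompactOperator
          ((Ψ t : H →L[ℝ] H) ∘L T t ∘L ContinuousLinearMap.adjoint (Ψ t : H →L[ℝ] H) - Jtilde) := by
  obtain ⟨W, U, hU, hW⟩ := hV.compactlyTrivial hab hVcodim
  have ha : a ∈ Icc a b := ⟨le_rfl, hab⟩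
  have hWclosed : IsClosed (W : Set H) := by
    rw [← hW a ha]
    exact (equiv (U a)).toHomeomorph.isClosedMap _ (hV.1 a ha)
  have : FiniteDimensional ℝ (H ⧸ V a) := hVcodim a ha
  refine ⟨W, fun t => (equiv (U t)).toContinuousLinearEquiv, J,
    ⟨⟨hWclosed, ?_, hW⟩, fun t _ => (U t).1.2⟩,
    finiteDimensional_quotient_map (equiv (U a)).toLinearEquiv (hW a ha), hJ, fun t ht => ?_⟩
  · exact (continuous_subtype_val.comp continuous_subtype_val).comp_continuousOn hU
  · simp only [coe_equiv]
    have h : (U t).1.1 ∘L T t ∘L ContinuousLinearMap.adjoint (U t).1.1 - J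
        = ((U t).1.1 ∘L J ∘L ContinuousLinearMap.adjoint (U t).1.1 - J)
          + (U t).1.1 ∘L (K t ∘L ContinuousLinearMap.adjoint (U t).1.1) := by
      rw [hT t ht]
      ext x
      simp only [ContinuousLinearMap.comp_apply, add_apply, sub_apply, map_add]
      abel
    rw [h]
    exact (isCompactOperator_conj_sub (U t) J).add
      (((hK t ht).2.comp_clm _).clm_comp _)
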